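/- **Setting.** Let $[1]^n=\{0<1\}^n$, $n\ge 0$. For a nonempty $A\subseteq\{\mathrm t,\mathrm r\}$ let $\square^A$ be the category with objects $[1]^n$, $n\ge 0$, whose morphisms are the maps of sets generated under composition by the faces $(v_1,\dots,v_{n-1})\mapsto(v_1,\dots,v_{i-1},\varepsilon,v_i,\dots,v_{n-1})$ with $\varepsilon\in\{0,1\}$, the degeneracies (which delete one coordinate), the connections $(v_1,\dots,v_{n+1})\mapsto(v_1,\dots,v_{i-1},m^\varepsilon(v_i,v_{i+1}),v_{i+2},\dots,v_{n+1})$ for $1\le i\le n$ with $m^0=\max$, $m^1=\min$, and, if $\mathrm t\in A$, the simple transpositions (which exchange $v_i$ and $v_{i+1}$) and, if $\mathrm r\in A$, the simple reversals (which replace $v_i$ by $1-v_i$). An *$A$-symmetry* of $[1]^n$ is a composition of simple transpositions (allowed if $\mathrm t\in A$) and simple reversals (allowed if $\mathrm r\in A$); its sign $\operatorname{sgn}(t)$ is $1$ if $t$ can be written as a composition of an even number of simple transpositions and simple reversals, and $-1$ otherwise. A cubical $R$-module with $A$-symmetries is a functor $X\colon(\square^A)^{\mathrm{op}}\to\mathbf{Mod}(R)$.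 Its chain complex $C_*X$, in degrees $n\ge 0$, has $C_nX=X([1]^n)/D_n$, where $D_n$ is generated by the images of the degeneracies (and $D_0=0$), with differential $\partial_n=\sum_{i=1}^n(-1)^{i-1}(d_i^0-d_i^1)$ for $n\ge 1$, where $d_i^\varepsilon$ is induced by the face map that inserts $\varepsilon$ as $i$-th coordinate. Write $H_*(X)=H_*(C_*X)$. The $A$-symmetries of $[1]^n$ act on $C_nX$. The *$A$-symmetry sub-complex* $S^A_*X\subseteq C_*X$ is the sub-complex generated by all chains $x-\operatorname{sgn}(t)\,tx$ with $x\in C_nX$, $t$ an $A$-symmetry of $[1]^n$, $n\ge 0$. **Theorem.** Let $R$ be a field and let $\emptyset\ne A\subseteq\{\mathrm t,\mathrm r\}$. Assume that $\operatorname{char}R=0$, or that $A=\{\mathrm r\}$ and $\operatorname{char}R\neq 2$. Let $X$ be a cubical $R$-module with $A$-symmetries. Then: 1. in each degree $n$, $S^A_nX$ is the $R$-linear span of the chains $x-\operatorname{sgn}(t)\,tx$ with $x\in C_nX$ and $t$ an $A$-symmetry of $[1]^n$; 2. $S^A_*X$ is acyclic, i.e. all its homology modules vanish; 3. the projection $C_*X\to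 C_*X/S^A_*X$ induces isomorphisms $H_n(X)\cong H_n(C_*X/S^A_*X)$ for all $n\ge 0$; 4. if the image in $C_nX/S^A_nX$ of a chain $\alpha\in C_nX$ is a cycle and $t$ is an $A$-symmetry of $[1]^n$, then the image of $t\alpha$ is a cycle as well, and $[t\alpha]=\operatorname{sgn}(t)[\alpha]$ in $H_n(C_*X/S^A_*X)$. -/

import Mathlib

open CategoryTheory Opposite

universe u v

namespace CubicalSymm

/-! ### The cube categories -/

/-- The two kinds of symmetries that may be adjoined to the cube category. -/
inductive SymmKind
  | transposition
  | reversal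

/-- The underlying set of the cube `[1]^n = {0 < 1}^n`; `false` is `0` and `true` is `1`.
Coordinates are indexed by `0, …, n - 1`. -/
abbrev Vertex (n : ℕ) : Type := Fin n → Bool

/-- The face map that inserts `ε` as the `i`-th coordinate. -/
def faceMap {n : ℕ} (i : Fin (n + 1)) (ε : Bool) : Vertex n → Vertex (n + 1) :=
  fun v => i.insertNth (α := fun _ => Bool) ε v

/-- The degeneracy that deletes the `i`-th coordinate. -/
def degeneracyMap {n : ℕ} (i : Fin (n + 1)) : Vertex (n + 1) → Vertex n :=
  fun v => i.removeNth v

/-- The connection that replaces the two consecutive coordinates `v_i, v_{i+1}` by the single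
coordinate `max v_i v_{i+1}` (if `ε = 0`) or `min v_i v_{i+1}` (if `ε = 1`). -/
def connectionMap {n : ℕ} (i : Fin n) (ε : Bool) : Vertex (n + 1) → Vertex n :=
  fun v j =>
    if j < i then v j.castSucc
    else if j = i then
      (if ε then min (v i.castSucc) (v i.succ) else max (v i.castSucc) (v i.succ))
    else v j.succ

/-- The simple transposition that exchanges the coordinates `i` and `i + 1`. -/
def transpositionMap {n : ℕ} (i : Fin n) : Vertex (n + 1) → Vertex (n + 1) :=
  fun v => v ∘ Equiv.swap i.castSucc i.succ

/-- The simple reversal that replaces the coordinate `v_i` by `1 - v_i`. -/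
def reversalMap {n : ℕ} (i : Fin n) : Vertex n → Vertex n :=
  fun v => Function.update v i (!(v i))

/-- The simple symmetries of `[1]^n` of the kinds in `A`. -/
inductive IsSimple (A : Set SymmKind) : ∀ {n : ℕ}, (Vertex n → Vertex n) → Prop
  | transposition {n : ℕ} (h : SymmKind.transposition ∈ A) (i : Fin n) :
      IsSimple A (transpositionMap i)
  | reversal {n : ℕ} (h : SymmKind.reversal ∈ A) (i : Fin n) :
      IsSimple A (reversalMap i)

/-- The maps between cubes generated under composition by the faces, the degeneracies, the
connections, and the simple symmetries of the kinds in `A`. -/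
inductive IsCubeMap (A : Set SymmKind) : ∀ {m n : ℕ}, (Vertex m → Vertex n) → Prop
  | id (n : ℕ) : IsCubeMap A (id : Vertex n → Vertex n)
  | comp {l m n : ℕ} {g : Vertex m → Vertex n} {f : Vertex l → Vertex m} :
      IsCubeMap A g → IsCubeMap A f → IsCubeMap A (g ∘ f)
  | face {n : ℕ} (i : Fin (n + 1)) (ε : Bool) : IsCubeMap A (faceMap i ε)
  | degeneracy {n : ℕ} (i : Fin (n + 1)) : IsCubeMap A (degeneracyMap i)
  | connection {n : ℕ} (i : Fin n) (ε : Bool) : IsCubeMap A (connectionMap i ε)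
  | simple {n : ℕ} {t : Vertex n → Vertex n} : IsSimple A t → IsCubeMap A t

/-- The cube category (with connections) with `A`-symmetries; the object of dimension `n` is
`[1]^n`. -/
structure CubeCat (A : Set SymmKind) where
  dim : ℕ

instance (A : Set SymmKind) : Category.{0} (CubeCat A) where
  Hom a b := {f : Vertex a.dim → Vertex b.dim // IsCubeMap A f}
  id a := ⟨id, IsCubeMap.id a.dim⟩
  comp f g := ⟨g.1 ∘ f.1, IsCubeMap.comp g.2 f.2⟩

/-- Cubical `R`-modules with connections and `A`-symmetries. -/
abbrev CubicalModule (A : Set SymmKind) (R : Type u) [Ring R] :=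
  (CubeCat A)ᵒᵖ ⥤ ModuleCat.{v} R

/-- `IsComposite A k t` says that `t` is a composition of `k` simple symmetries of `[1]^n` of the
kinds in `A`. -/
inductive IsComposite (A : Set SymmKind) {n : ℕ} : ℕ → (Vertex n → Vertex n) → Prop
  | nil : IsComposite A 0 id
  | cons {k : ℕ} {g t : Vertex n → Vertex n} :
      IsSimple A g → IsComposite A k t → IsComposite A (k + 1) (g ∘ t)

/-- The `A`-symmetries of `[1]^n`: compositions of simple symmetries of the kinds in `A`. -/
def IsSymmetry (A : Set SymmKind) {n : ℕ} (t : Vertex n → Vertex n) : Prop :=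
  ∃ k, IsComposite A k t

open Classical in
/-- The sign of a symmetry `t` of `[1]^n`: it is `1` if `t` is the composition of an even number
of simple transpositions and simple reversals, and `-1` otherwise. -/
noncomputable def sgn {n : ℕ} (t : Vertex n → Vertex n) : ℤ :=
  if ∃ k, Even k ∧ IsComposite Set.univ k t then 1 else -1

lemma IsComposite.isCubeMap {A : Set SymmKind} {n k : ℕ} {t : Vertex n → Vertex n}
    (ht : IsComposite A k t) : IsCubeMap A t := by
  induction ht with
  | nil => exact .id n
  | cons hg _ ih => exact .comp (.simple hg) ih

lemma IsSymmetry.isCubeMap {A : Set SymmKind} {n : ℕ} {t : Vertex n → Vertex n}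
    (ht : IsSymmetry A t) : IsCubeMap A t :=
  ht.choose_spec.isCubeMap

/-! ### Identities between maps of cubes -/

lemma faceMap_comm {n : ℕ} (i : Fin (n + 2)) (j : Fin (n + 1)) (ε η : Bool) :
    faceMap i ε ∘ faceMap j η =
      faceMap (i.succAbove j) η ∘ faceMap (j.predAbove i) ε := by
  funext v
  simp only [Function.comp, faceMap]
  rw [Fin.insertNth_eq_iff]
  constructor
  · conv_rhs => arg 4; rw [← Fin.succAbove_succAbove_predAbove i j]
    rw [Fin.insertNth_apply_succAbove, Fin.insertNth_apply_same]
  · symm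
    rw [Fin.eq_insertNth_iff]
    constructor
    · simp [Fin.removeNth]
    · funext k
      simp only [Fin.removeNth]
      rw [← Fin.succAbove_succAbove_succAbove_predAbove i j k]
      simp

lemma degeneracyMap_comp_faceMap_self {n : ℕ} (i : Fin (n + 1)) (ε : Bool) :
    degeneracyMap i ∘ faceMap i ε = id := by
  funext v
  simp [degeneracyMap, faceMap]

lemma degeneracyMap_comp_faceMap {n : ℕ} (i : Fin (n + 2)) (j : Fin (n + 1)) (ε : Bool) :
    degeneracyMap (i.succAbove j) ∘ faceMap i ε =
      faceMap (j.predAbove i) ε ∘ degeneracyMap j := by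
  funext v
  simp only [Function.comp, faceMap, degeneracyMap]
  rw [Fin.eq_insertNth_iff]
  constructor
  · simp only [Fin.removeNth]
    rw [Fin.succAbove_succAbove_predAbove, Fin.insertNth_apply_same]
  · funext k
    simp only [Fin.removeNth]
    rw [Fin.succAbove_succAbove_succAbove_predAbove, Fin.insertNth_apply_succAbove]

/-- A degeneracy after a simple symmetry is, up to a simple symmetry on the left, a degeneracy. -/
lemma degeneracyMap_comp_simple {A : Set SymmKind} {n : ℕ} (i : Fin (n + 1))
    {t : Vertex (n + 1) → Vertex (n + 1)} (ht : IsSimple A t) :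
    ∃ (s : Vertex n → Vertex n) (j : Fin (n + 1)),
      IsCubeMap A s ∧ degeneracyMap i ∘ t = s ∘ degeneracyMap j := by
  cases ht with
  | transposition h c =>
    by_cases h1 : i = c.castSucc
    · subst h1
      refine ⟨_root_.id, c.succ, .id _, ?_⟩
      funext v k
      simp only [Function.comp, degeneracyMap, transpositionMap, Fin.removeNth, id]
      congr 1
      rw [Equiv.swap_apply_def]
      grind [Fin.succAbove]
    by_cases h2 : i = c.succ
    · subst h2
      refine ⟨_root_.id, c.castSucc, .id _, ?_⟩
      funext v k
      simp only [Function.comp, degeneracyMap, transpositionMap, Fin.removeNth, id]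
      congr 1
      rw [Equiv.swap_apply_def]
      grind [Fin.succAbove]
    obtain ⟨m, rfl⟩ : ∃ m, n = m + 1 := by
      refine ⟨n - 1, ?_⟩
      grind
    obtain ⟨e, he1, he2⟩ : ∃ e : Fin m,
        i.succAbove e.castSucc = c.castSucc ∧ i.succAbove e.succ = c.succ := by
      rcases lt_or_ge (i : ℕ) c with hlt | hge
      · exact ⟨⟨c - 1, by omega⟩, by grind [Fin.succAbove], by grind [Fin.succAbove]⟩
      · exact ⟨⟨c, by grind⟩, by grind [Fin.succAbove], by grind [Fin.succAbove]⟩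
    refine ⟨transpositionMap e, i, .simple (.transposition h e), ?_⟩
    funext v k
    simp only [Function.comp, degeneracyMap, transpositionMap, Fin.removeNth]
    rw [← he1, ← he2, Fin.succAbove_right_injective.swap_apply]
  | reversal h c =>
    by_cases h1 : i = c
    · subst h1
      refine ⟨_root_.id, i, .id _, ?_⟩
      funext v k
      simp [Function.comp, degeneracyMap, reversalMap, Fin.removeNth]
    · obtain ⟨e, rfl⟩ := Fin.exists_succAbove_eq (Ne.symm h1)
      refine ⟨reversalMap e, i, .simple (.reversal h e), ?_⟩
      funext v k
      simp [Function.comp, degeneracyMap, reversalMap, Fin.removeNth, Function.update_apply]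

/-! ### The alternating face map complex -/

section Complex

variable {A : Set SymmKind} {R : Type u} [Ring R] (X : CubicalModule.{u, v} A R)

/-- The module `X([1]^n)`. -/
abbrev cubes (n : ℕ) : ModuleCat.{v} R := X.obj (op (CubeCat.mk n))

/-- The map `X([1]^n) → X([1]^m)` induced by a morphism `f : [1]^m → [1]^n`. -/
def pull {m n : ℕ} (f : Vertex m → Vertex n) (hf : IsCubeMap A f) :
    cubes X n →ₗ[R] cubes X m :=
  (X.map (Quiver.Hom.op (⟨f, hf⟩ : CubeCat.mk m ⟶ CubeCat.mk n))).hom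

lemma pull_pull {l m n : ℕ} {g : Vertex m → Vertex n} {f : Vertex l → Vertex m}
    (hg : IsCubeMap A g) (hf : IsCubeMap A f) (x : cubes X n) :
    pull X f hf (pull X g hg x) = pull X (g ∘ f) (hg.comp hf) x := by
  have h := X.map_comp (Quiver.Hom.op (⟨g, hg⟩ : CubeCat.mk (A := A) m ⟶ CubeCat.mk n))
    (Quiver.Hom.op (⟨f, hf⟩ : CubeCat.mk (A := A) l ⟶ CubeCat.mk m))
  exact (congrArg (fun k => k.hom x) h).symm

lemma pull_id {n : ℕ} (x : cubes X n) : pull X id (IsCubeMap.id n) x = x :=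
  congrArg (fun k => k.hom x) (X.map_id (op (CubeCat.mk n)))

lemma pull_congr {m n : ℕ} {f g : Vertex m → Vertex n} (h : f = g) (hf : IsCubeMap A f)
    (x : cubes X n) : pull X f hf x = pull X g (h ▸ hf) x := by
  subst h; rfl

/-- The submodule of `X([1]^n)` generated by the images of the degeneracies. -/
def degenerate : ∀ n : ℕ, Submodule R (cubes X n)
  | 0 => ⊥
  | n + 1 => ⨆ i : Fin (n + 1), LinearMap.range (pull X (degeneracyMap i) (.degeneracy i))

/-- The difference `d_i^0 - d_i^1` of two opposite faces. -/
def faceDiff {n : ℕ} (i : Fin (n + 1)) : cubes X (n + 1) →ₗ[R] cubes X n :=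
  pull X (faceMap i false) (.face i false) - pull X (faceMap i true) (.face i true)

/-- The alternating sum of the `d_i^0 - d_i^1` (the first coordinate has the sign `+`). -/
def cubeBoundary (n : ℕ) : cubes X (n + 1) →ₗ[R] cubes X n :=
  ∑ i : Fin (n + 1), (-1 : ℤ) ^ (i : ℕ) • faceDiff X i

lemma faceDiff_comm {n : ℕ} (i : Fin (n + 2)) (j : Fin (n + 1)) (x : cubes X (n + 2)) :
    faceDiff X j (faceDiff X i x) =
      faceDiff X (j.predAbove i) (faceDiff X (i.succAbove j) x) := by
  simp only [faceDiff, LinearMap.sub_apply, map_sub, pull_pull]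
  rw [pull_congr X (faceMap_comm i j _ _), pull_congr X (faceMap_comm i j _ _),
    pull_congr X (faceMap_comm i j _ _), pull_congr X (faceMap_comm i j _ _)]
  abel

lemma cubeBoundary_cubeBoundary (n : ℕ) (x : cubes X (n + 2)) :
    cubeBoundary X n (cubeBoundary X (n + 1) x) = 0 := by
  simp only [cubeBoundary, LinearMap.sum_apply, LinearMap.smul_apply, map_sum, map_zsmul,
    Finset.smul_sum, smul_smul, ← pow_add]
  rw [← Finset.sum_product']
  refine Finset.sum_involution
    (fun p _ => (p.1.succAbove p.2, p.2.predAbove p.1)) ?_ ?_ ?_ ?_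
  · rintro ⟨i, j⟩ -
    dsimp only
    rw [← faceDiff_comm, Fin.neg_one_pow_succAbove_add_predAbove, neg_smul, add_neg_cancel]
  · rintro ⟨i, j⟩ - - h
    exact Fin.succAbove_ne i j (congrArg Prod.fst h)
  · exact fun _ _ => Finset.mem_univ _
  · rintro ⟨i, j⟩ -
    simp only [Fin.succAbove_succAbove_predAbove, Fin.predAbove_predAbove_succAbove]

lemma cubeBoundary_degenerate (n : ℕ) :
    degenerate X (n + 1) ≤ (degenerate X n).comap (cubeBoundary X n) := by
  refine iSup_le fun k => ?_
  rintro _ ⟨y, rfl⟩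
  simp only [Submodule.mem_comap, cubeBoundary, LinearMap.sum_apply, LinearMap.smul_apply]
  refine Submodule.sum_mem _ fun i _ => zsmul_mem ?_ _
  simp only [faceDiff, LinearMap.sub_apply, pull_pull]
  by_cases h : k = i
  · subst h
    rw [pull_congr X (degeneracyMap_comp_faceMap_self k _),
      pull_congr X (degeneracyMap_comp_faceMap_self k _), sub_self]
    exact Submodule.zero_mem _
  · obtain ⟨m, rfl⟩ : ∃ m, n = m + 1 := ⟨n - 1, by grind⟩
    obtain ⟨j, rfl⟩ := Fin.exists_succAbove_eq h
    rw [pull_congr X (degeneracyMap_comp_faceMap i j _),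
      pull_congr X (degeneracyMap_comp_faceMap i j _),
      ← pull_pull X (.face _ _) (.degeneracy _), ← pull_pull X (.face _ _) (.degeneracy _)]
    exact Submodule.sub_mem _ (Submodule.mem_iSup_of_mem j ⟨_, rfl⟩)
      (Submodule.mem_iSup_of_mem j ⟨_, rfl⟩)

/-- The module of `n`-chains `C_n X`: cubes modulo degenerate cubes. -/
abbrev Chains (n : ℕ) : Type v := cubes X n ⧸ degenerate X n

/-- The alternating face map complex `C_* X` of a cubical `R`-module. -/
noncomputable def cubeComplex : ChainComplex (ModuleCat.{v} R) ℕ :=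
  ChainComplex.of (fun n => ModuleCat.of R (Chains X n))
    (fun n => ModuleCat.ofHom
      (Submodule.mapQ _ _ (cubeBoundary X n) (cubeBoundary_degenerate X n)))
    (fun n => by
      ext x
      simp [cubeBoundary_cubeBoundary])

lemma pull_degenerate {n : ℕ} {t : Vertex n → Vertex n} (ht : IsSymmetry A t) :
    degenerate X n ≤ (degenerate X n).comap (pull X t ht.isCubeMap) := by
  obtain ⟨k, hk⟩ := ht
  suffices h : ∀ x ∈ degenerate X n, pull X t hk.isCubeMap x ∈ degenerate X n from h
  induction hk with
  | nil =>
    intro x hx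
    rwa [pull_id]
  | cons hg ht ih =>
    intro x hx
    rw [← pull_pull X (.simple hg) ht.isCubeMap]
    refine ih _ ?_
    cases n with
    | zero =>
      rw [(Submodule.mem_bot R).mp hx, map_zero]
      exact Submodule.zero_mem _
    | succ n =>
      revert x
      change degenerate X (n + 1) ≤ (degenerate X (n + 1)).comap _
      refine iSup_le fun k => ?_
      rintro _ ⟨y, rfl⟩
      obtain ⟨s, j, hs, h⟩ := degeneracyMap_comp_simple k hg
      rw [Submodule.mem_comap, pull_pull, pull_congr X h, ← pull_pull X hs (.degeneracy j)]
      exact Submodule.mem_iSup_of_mem j ⟨_, rfl⟩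

/-- The action of an `A`-symmetry `t` of `[1]^n` on the chains `C_n X`. -/
noncomputable def symmAct {n : ℕ} (t : Vertex n → Vertex n) (ht : IsSymmetry A t) :
    (cubeComplex X).X n →ₗ[R] (cubeComplex X).X n :=
  Submodule.mapQ (degenerate X n) (degenerate X n) (pull X t ht.isCubeMap) (pull_degenerate X ht)

end Complex

/-! ### Sub-complexes of a complex of modules -/

section Subcomplex

variable {R : Type u} [Ring R] {ι : Type*} {c : ComplexShape ι}

/-- A sub-complex of a complex of modules. -/
structure Subcomplex (K : HomologicalComplex (ModuleCat.{v} R) c) where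
  carrier : ∀ i, Submodule R (K.X i)
  d_mem : ∀ i j, ∀ x ∈ carrier i, (K.d i j).hom x ∈ carrier j

namespace Subcomplex

variable {K : HomologicalComplex (ModuleCat.{v} R) c}

/-- The smallest sub-complex that contains the given chains. -/
def generatedBy (S : ∀ i, Set (K.X i)) : Subcomplex K where
  carrier i := ⨅ (T : Subcomplex K) (_ : ∀ j, S j ⊆ T.carrier j), T.carrier i
  d_mem i j x hx := by
    simp only [Submodule.mem_iInf] at hx ⊢
    exact fun T hT => T.d_mem i j x (hx T hT)

/-- A sub-complex as a complex. -/
def toComplex (T : Subcomplex K) : HomologicalComplex (ModuleCat.{v} R) c where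
  X i := ModuleCat.of R (T.carrier i)
  d i j := ModuleCat.ofHom ((K.d i j).hom.restrict (T.d_mem i j))
  shape i j hij := by
    ext x
    simp [K.shape i j hij]
  d_comp_d' i j k _ _ := by
    ext x
    simp [← ModuleCat.comp_apply]

/-- The quotient of a complex by a sub-complex. -/
def quotient (T : Subcomplex K) : HomologicalComplex (ModuleCat.{v} R) c where
  X i := ModuleCat.of R (K.X i ⧸ T.carrier i)
  d i j := ModuleCat.ofHom (Submodule.mapQ _ _ (K.d i j).hom (T.d_mem i j))
  shape i j hij := by
    ext x
    simp [K.shape i j hij]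
  d_comp_d' i j k _ _ := by
    ext x
    simp [← ModuleCat.comp_apply]

/-- The projection of a complex onto its quotient by a sub-complex. -/
def proj (T : Subcomplex K) : K ⟶ T.quotient where
  f i := ModuleCat.ofHom (T.carrier i).mkQ
  comm' _ _ _ := rfl

end Subcomplex

/-- The chain `x` of degree `i` is a cycle, and `h` is its homology class. -/
def IsClassOf {K : HomologicalComplex (ModuleCat.{v} R) c} {i : ι} (h : K.homology i)
    (x : K.X i) : Prop :=
  ∃ z : K.cycles i, (K.iCycles i).hom z = x ∧ (K.homologyπ i).hom z = h

end Subcomplex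

section Main

variable {A : Set SymmKind} {R : Type u} [Ring R] (X : CubicalModule.{u, v} A R)

/-- The `n`-chains of the form `x - sgn(t) t x` for an `A`-symmetry `t` and a chain `x`. -/
def symmChains (n : ℕ) : Set ((cubeComplex X).X n) :=
  {y | ∃ (t : Vertex n → Vertex n) (ht : IsSymmetry A t) (x : (cubeComplex X).X n),
    y = x - sgn t • symmAct X t ht x}

/-- The `A`-symmetry sub-complex: the sub-complex of `C_* X` generated by the chains
`x - sgn(t) t x`. -/
noncomputable def symmSubcomplex : Subcomplex (cubeComplex X) :=
  Subcomplex.generatedBy (symmChains X)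

end Main

end CubicalSymm

open CubicalSymm

namespace CubicalSymm

/-! ### The sign of a symmetry -/

/-! Let `F_k` in `X([1]^n)` be spanned by the degenerate cubes and all `x + s x`, `s` a simple
symmetry of the first `k` coordinates (`symmFiltration`). Simple symmetries have sign `-1` and
compositions telescope, so modulo degenerate cubes `F_n` is the span of the chains `x - sgn(t) t x`
(`span_symmChains`), while `F_0` is zero. The first `k + 1` terms of the boundary map `F_{k+1}` into
`F_k` (`lowerBoundary_mem_symmFiltration`): on `x + s x` the faces affected by `s` cancel, and the
other faces commute with `s` up to renumbering. For top `k` this shows that the spans already form a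
sub-complex.

For acyclicity, a cycle `y` in `F_{k+1}` is pushed down to `F_k` by subtracting a boundary
(`exists_boundary_sub_mem`). Let `G` be the group of symmetries of the first `k + 1` coordinates, `N
= |G|`, and `γ` the connection taking the maximum of coordinates `k` and `k + 1` (counted from `0`).
Put `w = ∑ (γ y - sgn(t) t γ y)` over `t ∈ G`. In the boundary of `w`, the first `k + 1` terms lie
in `F_k`; the term of coordinate `k + 1` is `± N y` modulo degenerate cubes, because `∑ sgn(t) t`
kills `F_{k+1}`; the remaining terms come from the upper part of the boundary of `y`, which lies in
`F_k` since `y` is a cycle. The assumption on the characteristic makes `N` invertible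
(`card_symmetries_ne_zero`), and induction reaches `F_0`.

The long exact homology sequence then makes the projection a quasi-isomorphism. In the quotient `t α
= sgn(t) α` holds already for chains, which gives the statement on classes. -/

lemma IsComposite.exists_signed_perm {n k : ℕ} {t : Vertex n → Vertex n}
    (ht : IsComposite Set.univ k t) :
    ∃ (σ : Equiv.Perm (Fin n)) (w : Fin n → Bool), (t = fun v i => xor (v (σ i)) (w i)) ∧
      (σ.sign : ℤ) * ∏ i, (if w i then -1 else 1 : ℤ) = (-1) ^ k := by
  induction ht with
  | nil => exact ⟨1, fun _ => false, by funext v i; simp, by simp⟩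
  | cons hg _ ih =>
    obtain ⟨σ, w, rfl, hs⟩ := ih
    cases hg with
    | transposition _ i =>
      refine ⟨σ * Equiv.swap i.castSucc i.succ, w ∘ Equiv.swap i.castSucc i.succ, rfl, ?_⟩
      have h := Equiv.prod_comp (Equiv.swap i.castSucc i.succ) fun j => (if w j then -1 else 1 : ℤ)
      simp only [Function.comp, h, Equiv.Perm.sign_mul,
        Equiv.Perm.sign_swap (Fin.castSucc_lt_succ (i := i)).ne, pow_succ, ← hs]
      push_cast
      ring
    | reversal _ i =>
      refine ⟨σ, Function.update w i (!(w i)), ?_, ?_⟩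
      · funext v j
        by_cases h : j = i
        · subst h; simp [reversalMap]
        · simp [reversalMap, h]
      · rw [pow_succ, ← hs, mul_assoc, ← Finset.mul_prod_erase _ _ (Finset.mem_univ i),
          ← Finset.mul_prod_erase _ (fun j => (if w j then -1 else 1 : ℤ)) (Finset.mem_univ i)]
        rw [Finset.prod_congr rfl (g := fun j => (if w j then -1 else 1 : ℤ))
          (fun j hj => by rw [Function.update_of_ne (Finset.ne_of_mem_erase hj)])]
        cases w i <;> simp

/-- The permutation and the set of reversed coordinates can be read off from `t`, so the parity of
the number of simple factors depends only on `t`. -/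
lemma IsComposite.neg_one_pow_eq {n k l : ℕ} {t : Vertex n → Vertex n}
    (hk : IsComposite Set.univ k t) (hl : IsComposite Set.univ l t) :
    (-1 : ℤ) ^ k = (-1) ^ l := by
  obtain ⟨σ, w, h, hs⟩ := hk.exists_signed_perm
  obtain ⟨σ', w', h', hs'⟩ := hl.exists_signed_perm
  rw [h] at h'
  have hw : w = w' := by
    funext i
    simpa using congrFun (congrFun h' fun _ => false) i
  subst hw
  have hσ : σ = σ' := by
    ext1 i
    by_contra hne
    -- The vertex whose only coordinate `1` is at `σ i` separates `σ i` from `σ' i`.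
    have := congrFun (congrFun h' fun j => decide (j = σ i)) i
    simp [Ne.symm hne] at this
  rw [← hs, ← hs', hσ]

lemma IsSimple.mono {A B : Set SymmKind} (h : A ⊆ B) {n : ℕ} {t : Vertex n → Vertex n}
    (ht : IsSimple A t) : IsSimple B t := by
  cases ht with
  | transposition h' i => exact .transposition (h h') i
  | reversal h' i => exact .reversal (h h') i

lemma IsComposite.mono {A B : Set SymmKind} (h : A ⊆ B) {n k : ℕ} {t : Vertex n → Vertex n}
    (ht : IsComposite A k t) : IsComposite B k t := by
  induction ht with
  | nil => exact .nil
  | cons hg _ ih => exact .cons (hg.mono h) ih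

lemma IsComposite.sgn_eq {A : Set SymmKind} {n k : ℕ} {t : Vertex n → Vertex n}
    (ht : IsComposite A k t) : sgn t = (-1) ^ k := by
  have ht' := ht.mono (Set.subset_univ A)
  unfold sgn
  split_ifs with h
  · obtain ⟨l, hl, h⟩ := h
    rw [ht'.neg_one_pow_eq h, hl.neg_one_pow]
  · rw [Odd.neg_one_pow]
    rw [← Nat.not_even_iff_odd]
    exact fun hk => h ⟨k, hk, ht'⟩

lemma IsSimple.isComposite {A : Set SymmKind} {n : ℕ} {s : Vertex n → Vertex n}
    (hs : IsSimple A s) : IsComposite A 1 s :=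
  .cons hs .nil

lemma IsSimple.isSymmetry {A : Set SymmKind} {n : ℕ} {s : Vertex n → Vertex n}
    (hs : IsSimple A s) : IsSymmetry A s :=
  ⟨1, hs.isComposite⟩

lemma sgn_mul_self {n : ℕ} (t : Vertex n → Vertex n) : sgn t * sgn t = 1 := by
  unfold sgn
  split_ifs <;> rfl

lemma IsSymmetry.comp_simple {A : Set SymmKind} {n : ℕ} {s t : Vertex n → Vertex n}
    (hs : IsSimple A s) (ht : IsSymmetry A t) : IsSymmetry A (s ∘ t) :=
  ⟨_, .cons hs ht.choose_spec⟩

lemma sgn_simple_comp {A : Set SymmKind} {n : ℕ} {s t : Vertex n → Vertex n}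
    (hs : IsSimple A s) (ht : IsSymmetry A t) : sgn (s ∘ t) = - sgn t := by
  obtain ⟨k, hk⟩ := ht
  rw [hk.sgn_eq, (IsComposite.cons hs hk).sgn_eq, pow_succ, mul_neg_one]

lemma IsSimple.comp_self {A : Set SymmKind} {n : ℕ} {s : Vertex n → Vertex n}
    (hs : IsSimple A s) : s ∘ s = id := by
  cases hs with
  | transposition _ i => funext v j; simp [transpositionMap]
  | reversal _ i =>
    funext v j
    by_cases h : j = i
    · subst h; simp [reversalMap]
    · simp [reversalMap, h]

/-! ### Symmetries of the first coordinates -/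

/-- Indexing by `ℕ` turns identities between cube maps into arithmetic of indices; the values
outside the range are arbitrary. -/
lemma Vertex.exists_eq_nat {n : ℕ} (v : Vertex n) : ∃ u : ℕ → Bool, v = fun j : Fin n => u j :=
  ⟨fun j => if h : j < n then v ⟨j, h⟩ else false, by simp⟩

/-- The simple symmetries of `[1]^n` of the kinds in `A` that only involve the first `k`
coordinates. -/
inductive IsSimpleBelow (A : Set SymmKind) (k : ℕ) : ∀ {n : ℕ}, (Vertex n → Vertex n) → Prop
  | transposition {n : ℕ} (h : SymmKind.transposition ∈ A) (i : Fin n) (hi : (i : ℕ) + 1 < k) :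
      IsSimpleBelow A k (transpositionMap i)
  | reversal {n : ℕ} (h : SymmKind.reversal ∈ A) (i : Fin n) (hi : (i : ℕ) < k) :
      IsSimpleBelow A k (reversalMap i)

lemma IsSimpleBelow.isSimple {A : Set SymmKind} {k n : ℕ} {s : Vertex n → Vertex n}
    (hs : IsSimpleBelow A k s) : IsSimple A s := by
  cases hs with
  | transposition h i => exact .transposition h i
  | reversal h i => exact .reversal h i

lemma IsSimpleBelow.mono {A : Set SymmKind} {k l n : ℕ} (h : k ≤ l) {s : Vertex n → Vertex n}
    (hs : IsSimpleBelow A k s) : IsSimpleBelow A l s := by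
  cases hs with
  | transposition h' i hi => exact .transposition h' i (by omega)
  | reversal h' i hi => exact .reversal h' i (by omega)

/-- The extension to `[1]^n` of a self-map of `[1]^k` by the identity on the remaining
coordinates (for `k ≤ n`). -/
def extendMap {k : ℕ} (n : ℕ) (t : Vertex k → Vertex k) : Vertex n → Vertex n := fun v j =>
  if h : (j : ℕ) < k then t (fun i => if h' : (i : ℕ) < n then v ⟨i, h'⟩ else false) ⟨j, h⟩
  else v j

lemma extendMap_self {n : ℕ} (t : Vertex n → Vertex n) : extendMap n t = t := by
  funext v j
  simp [extendMap]

lemma extendMap_id {k n : ℕ} : extendMap n (id : Vertex k → Vertex k) = id := by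
  funext v j
  simp [extendMap]

lemma extendMap_comp {k n : ℕ} (h : k ≤ n) (s t : Vertex k → Vertex k) :
    extendMap n (s ∘ t) = extendMap n s ∘ extendMap n t := by
  funext v j
  simp only [extendMap, Function.comp]
  split_ifs with hj
  · congr 1
    funext i
    rw [dif_pos (by omega)]
    simp
  · rfl

lemma extendMap_transpositionMap {k n : ℕ} (i : Fin k) (h : k ≤ n) :
    extendMap (n + 1) (transpositionMap i) = transpositionMap (Fin.castLE h i) := by
  funext v j
  obtain ⟨u, rfl⟩ := v.exists_eq_nat
  simp only [extendMap, transpositionMap, Function.comp, Equiv.swap_apply_def, Fin.ext_iff,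
    apply_ite Fin.val, Fin.val_castSucc, Fin.val_succ, Fin.val_castLE]
  grind

lemma extendMap_reversalMap {k n : ℕ} (i : Fin k) (h : k ≤ n) :
    extendMap n (reversalMap i) = reversalMap (Fin.castLE h i) := by
  funext v j
  simp only [extendMap, reversalMap, Function.update_apply]
  grind

lemma IsSimple.extendMap {A : Set SymmKind} {k n : ℕ} (h : k ≤ n) {s : Vertex k → Vertex k}
    (hs : IsSimple A s) : IsSimpleBelow A k (extendMap n s) := by
  cases hs with
  | transposition h' i =>
    obtain ⟨m, rfl⟩ : ∃ m, n = m + 1 := ⟨n - 1, by omega⟩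
    rw [extendMap_transpositionMap i (by omega)]
    exact .transposition h' _ (by simp)
  | reversal h' i =>
    rw [extendMap_reversalMap i h]
    exact .reversal h' _ i.2

lemma IsSimpleBelow.exists_extendMap {A : Set SymmKind} {k n : ℕ} (h : k ≤ n)
    {s : Vertex n → Vertex n} (hs : IsSimpleBelow A k s) :
    ∃ s' : Vertex k → Vertex k, IsSimple A s' ∧ CubicalSymm.extendMap n s' = s := by
  cases hs with
  | transposition h' i hi =>
    obtain ⟨m, rfl⟩ : ∃ m, k = m + 1 := ⟨k - 1, by omega⟩
    exact ⟨_, .transposition h' ⟨i, by omega⟩, extendMap_transpositionMap _ (by omega)⟩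
  | reversal h' i hi =>
    exact ⟨_, .reversal h' ⟨i, hi⟩, extendMap_reversalMap _ h⟩

lemma IsComposite.extendMap {A : Set SymmKind} {k n m : ℕ} (h : k ≤ n) {t : Vertex k → Vertex k}
    (ht : IsComposite A m t) : IsComposite A m (extendMap n t) := by
  induction ht with
  | nil => rw [extendMap_id]; exact .nil
  | cons hg _ ih =>
    rw [extendMap_comp h]
    exact .cons (hg.extendMap h).isSimple ih

lemma IsSymmetry.extendMap {A : Set SymmKind} {k n : ℕ} (h : k ≤ n) {t : Vertex k → Vertex k}
    (ht : IsSymmetry A t) : IsSymmetry A (extendMap n t) :=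
  ⟨_, ht.choose_spec.extendMap h⟩

lemma faceMap_lt {n : ℕ} (j : Fin (n + 1)) (ε : Bool) (v : Vertex n) (i : Fin (n + 1))
    (h : (i : ℕ) < j) : faceMap j ε v i = v ⟨i, by omega⟩ := by
  simp only [faceMap]
  rw [Fin.insertNth_apply_below (by exact h), eq_rec_constant]
  rfl

lemma faceMap_gt {n : ℕ} (j : Fin (n + 1)) (ε : Bool) (v : Vertex n) (i : Fin (n + 1))
    (h : (j : ℕ) < i) : faceMap j ε v i = v ⟨i - 1, by omega⟩ := by
  simp only [faceMap]
  rw [Fin.insertNth_apply_above (by exact h), eq_rec_constant]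
  rfl

lemma faceMap_self {n : ℕ} (j : Fin (n + 1)) (ε : Bool) (v : Vertex n) :
    faceMap j ε v j = ε := by
  simp [faceMap]

lemma faceMap_apply {n : ℕ} (j : Fin (n + 1)) (ε : Bool) (v : Vertex n) (i : Fin (n + 1)) :
    faceMap j ε v i = if h : (i : ℕ) < j then v ⟨i, by omega⟩ else
      if h' : (j : ℕ) < i then v ⟨i - 1, by omega⟩ else ε := by
  split_ifs with h h'
  · exact faceMap_lt j ε v i h
  · exact faceMap_gt j ε v i h'
  · rw [show i = j by omega, faceMap_self]

lemma extendMap_comp_faceMap {k n : ℕ} (t : Vertex k → Vertex k) (j : Fin (n + 1))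
    (hj : k ≤ j) (ε : Bool) :
    extendMap (n + 1) t ∘ faceMap j ε = faceMap j ε ∘ extendMap n t := by
  funext v i
  simp only [Function.comp, faceMap_apply _ _ (extendMap n t v)]
  by_cases hi : (i : ℕ) < k
  · simp only [extendMap, hi, dite_true, show (i : ℕ) < j by omega]
    congr 1
    funext l
    rw [dif_pos (by omega), dif_pos (by omega), faceMap_lt _ _ _ _ (by simp; omega)]
  · simp only [extendMap, hi, dite_false, faceMap_apply]
    grind

/-! ### Faces of symmetries and connections -/

lemma transpositionMap_comp_faceMap_castSucc {n : ℕ} (i : Fin n) (ε : Bool) :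
    transpositionMap i ∘ faceMap i.castSucc ε = faceMap i.succ ε := by
  funext v j
  obtain ⟨u, rfl⟩ := v.exists_eq_nat
  simp only [Function.comp, transpositionMap, faceMap_apply, Equiv.swap_apply_def, Fin.ext_iff,
    apply_ite Fin.val, Fin.val_castSucc, Fin.val_succ]
  grind

lemma transpositionMap_comp_faceMap_succ {n : ℕ} (i : Fin n) (ε : Bool) :
    transpositionMap i ∘ faceMap i.succ ε = faceMap i.castSucc ε := by
  funext v j
  obtain ⟨u, rfl⟩ := v.exists_eq_nat
  simp only [Function.comp, transpositionMap, faceMap_apply, Equiv.swap_apply_def, Fin.ext_iff,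
    apply_ite Fin.val, Fin.val_castSucc, Fin.val_succ]
  grind

lemma reversalMap_comp_faceMap_self {n : ℕ} (i : Fin (n + 1)) (ε : Bool) :
    reversalMap i ∘ faceMap i ε = faceMap i (!ε) := by
  funext v j
  simp only [Function.comp, reversalMap, faceMap_apply, Function.update_apply]
  grind

/-- The inserted coordinate is one of the first `k + 1` and is not moved. Without it, the two
exchanged coordinates are still adjacent and lie among the first `k`. One `s` serves both `ε`, as
`faceDiff` requires. -/
lemma transpositionMap_comp_faceMap {A : Set SymmKind} (h : SymmKind.transposition ∈ A)
    {n k : ℕ} (i : Fin n) (hi : (i : ℕ) + 1 < k + 1) (j : Fin (n + 1)) (hj : (j : ℕ) < k + 1)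
    (h1 : j ≠ i.castSucc) (h2 : j ≠ i.succ) :
    ∃ s : Vertex n → Vertex n, IsSimpleBelow A k s ∧
      ∀ ε, transpositionMap i ∘ faceMap j ε = faceMap j ε ∘ s := by
  obtain ⟨m, rfl⟩ : ∃ m, n = m + 1 := ⟨n - 1, by grind⟩
  obtain ⟨e, he1, he2, he3⟩ : ∃ e : Fin m,
      j.succAbove e.castSucc = i.castSucc ∧ j.succAbove e.succ = i.succ ∧ (e : ℕ) + 1 < k := by
    rcases lt_or_ge (j : ℕ) i with hlt | hge
    · exact ⟨⟨i - 1, by omega⟩, by grind [Fin.succAbove], by grind [Fin.succAbove], by grind⟩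
    · exact ⟨⟨i, by grind⟩, by grind [Fin.succAbove], by grind [Fin.succAbove], by grind⟩
  refine ⟨transpositionMap e, .transposition h e he3, fun ε => ?_⟩
  funext v
  simp only [Function.comp, faceMap, transpositionMap]
  rw [Fin.eq_insertNth_iff]
  constructor
  · simp only [Function.comp]
    rw [Equiv.swap_apply_of_ne_of_ne h1 h2, Fin.insertNth_apply_same]
  · funext l
    simp only [Fin.removeNth, Function.comp]
    rw [← he1, ← he2, Fin.succAbove_right_injective.swap_apply, Fin.insertNth_apply_succAbove]

lemma reversalMap_comp_faceMap {A : Set SymmKind} (h : SymmKind.reversal ∈ A)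
    {n k : ℕ} (i : Fin (n + 1)) (hi : (i : ℕ) < k + 1) (j : Fin (n + 1)) (hj : (j : ℕ) < k + 1)
    (h1 : j ≠ i) :
    ∃ s : Vertex n → Vertex n, IsSimpleBelow A k s ∧
      ∀ ε, reversalMap i ∘ faceMap j ε = faceMap j ε ∘ s := by
  obtain ⟨e, rfl⟩ := Fin.exists_succAbove_eq (Ne.symm h1)
  refine ⟨reversalMap e, .reversal h e ?_, fun ε => ?_⟩
  · grind [Fin.succAbove]
  · funext v
    simp only [Function.comp, faceMap, reversalMap]
    rw [Fin.eq_insertNth_iff]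
    constructor
    · simp
    · funext l
      simp [Fin.removeNth, Function.update_apply]

/-- The connection copies the coordinates before `i`, the only ones that `s` touches. -/
lemma IsSimpleBelow.comp_connectionMap {A : Set SymmKind} {n : ℕ} (i : Fin n) (ε : Bool)
    {s : Vertex n → Vertex n} (hs : IsSimpleBelow A i s) :
    ∃ s' : Vertex (n + 1) → Vertex (n + 1), IsSimpleBelow A i s' ∧
      s ∘ connectionMap i ε = connectionMap i ε ∘ s' := by
  cases hs with
  | transposition h a ha =>
    refine ⟨transpositionMap a.castSucc, .transposition h _ ha, ?_⟩
    funext v j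
    obtain ⟨u, rfl⟩ := v.exists_eq_nat
    simp only [Function.comp, transpositionMap, connectionMap, Equiv.swap_apply_def, Fin.ext_iff,
      Fin.lt_def, apply_ite Fin.val, Fin.val_castSucc, Fin.val_succ]
    grind
  | reversal h a ha =>
    refine ⟨reversalMap a.castSucc, .reversal h _ ha, ?_⟩
    funext v j
    obtain ⟨u, rfl⟩ := v.exists_eq_nat
    simp only [Function.comp, reversalMap, connectionMap, Function.update_apply, Fin.ext_iff,
      Fin.lt_def, Fin.val_castSucc, Fin.val_succ]
    grind

/-- `0` is neutral for `max`, and `1` for `min`. -/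
lemma connectionMap_comp_faceMap_succ {n : ℕ} (i : Fin n) (ε : Bool) :
    connectionMap i ε ∘ faceMap i.succ ε = id := by
  funext v j
  obtain ⟨u, rfl⟩ := v.exists_eq_nat
  simp only [Function.comp, connectionMap, faceMap_apply, Fin.ext_iff, Fin.lt_def, Fin.val_castSucc,
    Fin.val_succ, id]
  have hmin : ∀ b, min b true = b := by decide
  have hmax : ∀ b, max b false = b := by decide
  cases ε <;> grind

lemma connectionMap_comp_faceMap_above {n : ℕ} (i : Fin n) (ε η : Bool) (j : Fin (n + 1))
    (hj : (i : ℕ) < j) :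
    connectionMap i.castSucc ε ∘ faceMap j.succ η = faceMap j η ∘ connectionMap i ε := by
  funext v l
  obtain ⟨u, rfl⟩ := v.exists_eq_nat
  simp only [Function.comp, connectionMap, faceMap_apply, Fin.ext_iff, Fin.lt_def, Fin.val_castSucc,
    Fin.val_succ]
  grind

/-! ### Maps that factor through a degeneracy. -/

lemma degeneracyMap_apply {n : ℕ} (i : Fin (n + 1)) (v : Vertex (n + 1)) (j : Fin n) :
    degeneracyMap i v j = if (j : ℕ) < i then v j.castSucc else v j.succ := by
  simp only [degeneracyMap, Fin.removeNth, Fin.succAbove, Fin.lt_def, Fin.val_castSucc]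
  split_ifs <;> rfl

/-- The map `f` does not depend on the `i`-th coordinate. -/
def IsIndepOf {m n : ℕ} (f : Vertex m → Vertex n) (i : Fin m) : Prop :=
  ∀ v w : Vertex m, (∀ j, j ≠ i → v j = w j) → f v = f w

lemma IsIndepOf.eq_comp_degeneracyMap {m n : ℕ} {f : Vertex (m + 1) → Vertex n} {i : Fin (m + 1)}
    (hf : IsIndepOf f i) : f = (f ∘ faceMap i false) ∘ degeneracyMap i := by
  funext v
  refine hf _ _ fun j hj => ?_
  obtain ⟨l, rfl⟩ := Fin.exists_succAbove_eq hj
  simp [faceMap, degeneracyMap, Fin.removeNth]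

/-- The inserted value is absorbing for `max` or `min`, so the opposite face of a connection is
degenerate. -/
lemma isIndepOf_connectionMap_comp_faceMap_succ {n : ℕ} (i : Fin n) (ε : Bool) :
    IsIndepOf (connectionMap i ε ∘ faceMap i.succ (!ε)) i := by
  intro v w h
  funext j
  obtain ⟨u, rfl⟩ := v.exists_eq_nat
  obtain ⟨u', rfl⟩ := w.exists_eq_nat
  have h' : ∀ l, l < n → l ≠ i → u l = u' l := fun l hl hne => h ⟨l, hl⟩ (by grind)
  simp only [Function.comp, connectionMap, faceMap_apply, Fin.ext_iff, Fin.lt_def, Fin.val_castSucc,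
    Fin.val_succ]
  have hmin : ∀ b, min b false = false := by decide
  have hmax : ∀ b, max b true = true := by decide
  cases ε <;> grind

lemma isIndepOf_degeneracyMap_comp_connectionMap {n : ℕ} (l i : Fin (n + 1)) (ε : Bool) :
    ∃ j, IsIndepOf (degeneracyMap l ∘ connectionMap i ε) j := by
  rcases le_or_gt l i with hl | hl
  · refine ⟨l.castSucc, fun v w h => ?_⟩
    funext j
    obtain ⟨u, rfl⟩ := v.exists_eq_nat
    obtain ⟨u', rfl⟩ := w.exists_eq_nat
    have h' : ∀ a, a < n + 2 → a ≠ l → u a = u' a :=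
      fun a ha hne => h ⟨a, ha⟩ (by simpa [Fin.ext_iff] using hne)
    simp only [Function.comp, connectionMap, degeneracyMap_apply, Fin.ext_iff, Fin.lt_def,
      Fin.val_castSucc, Fin.val_succ]
    grind
  · refine ⟨l.succ, fun v w h => ?_⟩
    funext j
    obtain ⟨u, rfl⟩ := v.exists_eq_nat
    obtain ⟨u', rfl⟩ := w.exists_eq_nat
    have h' : ∀ a, a < n + 2 → a ≠ l + 1 → u a = u' a := fun a ha hne => h ⟨a, ha⟩ (by grind)
    simp only [Function.comp, connectionMap, degeneracyMap_apply, Fin.ext_iff, Fin.lt_def,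
      Fin.val_castSucc, Fin.val_succ]
    grind

end CubicalSymm

namespace CubicalSymm

variable {A : Set SymmKind} {R : Type u} [Ring R] (X : CubicalModule.{u, v} A R)

lemma pull_mem_degenerate {m n : ℕ} {f : Vertex (m + 1) → Vertex n} (hf : IsCubeMap A f)
    {i : Fin (m + 1)} (h : IsIndepOf f i) (x : cubes X n) :
    pull X f hf x ∈ degenerate X (m + 1) := by
  rw [pull_congr X h.eq_comp_degeneracyMap hf x,
    ← pull_pull X (.comp hf (.face i false)) (.degeneracy i)]
  exact Submodule.mem_iSup_of_mem i ⟨_, rfl⟩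

/-! ### The filtration of the symmetry sub-complex -/

/-- The submodule of `X([1]^n)` generated by the degenerate cubes and by the cubes `x + s x`, where
`s` is a simple symmetry of the first `k` coordinates. -/
def symmFiltration (k n : ℕ) : Submodule R (cubes X n) :=
  degenerate X n ⊔ Submodule.span R {y | ∃ (s : Vertex n → Vertex n) (hs : IsSimpleBelow A k s)
    (x : cubes X n), y = x + pull X s (.simple hs.isSimple) x}

lemma degenerate_le_symmFiltration (k n : ℕ) : degenerate X n ≤ symmFiltration X k n :=
  le_sup_left

lemma add_pull_mem_symmFiltration {k n : ℕ} {s : Vertex n → Vertex n} (hs : IsSimpleBelow A k s)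
    (x : cubes X n) : x + pull X s (.simple hs.isSimple) x ∈ symmFiltration X k n :=
  Submodule.mem_sup_right (Submodule.subset_span ⟨s, hs, x, rfl⟩)

lemma symmFiltration_le {k n : ℕ} {S : Submodule R (cubes X n)} (hD : degenerate X n ≤ S)
    (h : ∀ (s : Vertex n → Vertex n) (hs : IsSimpleBelow A k s) (x : cubes X n),
      x + pull X s (.simple hs.isSimple) x ∈ S) : symmFiltration X k n ≤ S := by
  refine sup_le hD (Submodule.span_le.mpr ?_)
  rintro _ ⟨s, hs, x, rfl⟩
  exact h s hs x

lemma symmFiltration_mono {k l : ℕ} (h : k ≤ l) (n : ℕ) :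
    symmFiltration X k n ≤ symmFiltration X l n :=
  symmFiltration_le X (degenerate_le_symmFiltration X l n) fun _ hs x =>
    add_pull_mem_symmFiltration X (hs.mono h) x

lemma symmFiltration_zero (n : ℕ) : symmFiltration X 0 n = degenerate X n := by
  refine le_antisymm (symmFiltration_le X le_rfl fun s hs x => ?_)
    (degenerate_le_symmFiltration X 0 n)
  cases hs with
  | transposition _ _ hi => omega
  | reversal _ _ hi => omega

/-- Telescoping: for `g ∘ t` with `g` simple, the chain is `x + g x` minus the chain of `t` at `g
x`. -/
lemma sub_zsmul_pull_mem_symmFiltration {k n m : ℕ} (hkn : k ≤ n) {t : Vertex k → Vertex k}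
    (ht : IsComposite A m t) (x : cubes X n) :
    x - (-1 : ℤ) ^ m • pull X (extendMap n t) (ht.extendMap hkn).isCubeMap x ∈
      symmFiltration X k n := by
  induction ht generalizing x with
  | nil => rw [pull_congr X extendMap_id, pull_id]; simp
  | @cons m g t hg ht ih =>
    have h := Submodule.sub_mem _ (add_pull_mem_symmFiltration X (hg.extendMap hkn) x)
      (ih (pull X (extendMap n g) (.simple (hg.extendMap hkn).isSimple) x))
    rw [pull_congr X (extendMap_comp hkn g t),
      ← pull_pull X (.simple (hg.extendMap hkn).isSimple) (ht.extendMap hkn).isCubeMap]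
    convert h using 1
    rw [pow_succ]
    simp only [mul_neg, mul_one, neg_smul]
    abel

/-! ### Partial boundaries -/

/-- The sum of the terms of the boundary that belong to the first `k` coordinates. -/
def lowerBoundary (k n : ℕ) : cubes X (n + 1) →ₗ[R] cubes X n :=
  ∑ i : Fin (n + 1), if (i : ℕ) < k then (-1 : ℤ) ^ (i : ℕ) • faceDiff X i else 0

/-- The sum of the terms of the boundary that do not belong to the first `k` coordinates. -/
def upperBoundary (k n : ℕ) : cubes X (n + 1) →ₗ[R] cubes X n :=
  ∑ i : Fin (n + 1), if (i : ℕ) < k then 0 else (-1 : ℤ) ^ (i : ℕ) • faceDiff X i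

lemma lowerBoundary_add_upperBoundary (k n : ℕ) :
    lowerBoundary X k n + upperBoundary X k n = cubeBoundary X n := by
  simp only [lowerBoundary, upperBoundary, cubeBoundary, ← Finset.sum_add_distrib]
  exact Finset.sum_congr rfl fun i _ => by split_ifs <;> simp

lemma lowerBoundary_self (n : ℕ) : lowerBoundary X (n + 1) n = cubeBoundary X n :=
  Finset.sum_congr rfl fun i _ => if_pos i.2

lemma upperBoundary_self (n : ℕ) : upperBoundary X (n + 1) n = 0 :=
  Finset.sum_eq_zero fun i _ => if_pos i.2

lemma upperBoundary_eq_add {n k : ℕ} (hk : k < n + 1) :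
    upperBoundary X k n =
      (-1 : ℤ) ^ k • faceDiff X ⟨k, hk⟩ + upperBoundary X (k + 1) n := by
  simp only [upperBoundary]
  rw [← Finset.add_sum_erase _ _ (Finset.mem_univ (⟨k, hk⟩ : Fin (n + 1))),
    ← Finset.add_sum_erase _ (fun i : Fin (n + 1) =>
      if (i : ℕ) < k + 1 then 0 else (-1 : ℤ) ^ (i : ℕ) • faceDiff X i)
      (Finset.mem_univ (⟨k, hk⟩ : Fin (n + 1)))]
  simp only [lt_irrefl, if_false, Nat.lt_succ_self, if_true, zero_add]
  congr 1
  refine Finset.sum_congr rfl fun i hi => ?_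
  have : (i : ℕ) ≠ k := fun h => Finset.ne_of_mem_erase hi (Fin.ext h)
  simp only [show (i : ℕ) < k + 1 ↔ (i : ℕ) < k by omega]

lemma faceDiff_mem_degenerate {n : ℕ} (i : Fin (n + 1)) {x : cubes X (n + 1)}
    (hx : x ∈ degenerate X (n + 1)) : faceDiff X i x ∈ degenerate X n := by
  suffices h : degenerate X (n + 1) ≤ (degenerate X n).comap (faceDiff X i) from h hx
  refine iSup_le fun k => ?_
  rintro _ ⟨y, rfl⟩
  simp only [Submodule.mem_comap, faceDiff, LinearMap.sub_apply, pull_pull]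
  by_cases h : k = i
  · subst h
    rw [pull_congr X (degeneracyMap_comp_faceMap_self k _),
      pull_congr X (degeneracyMap_comp_faceMap_self k _), sub_self]
    exact Submodule.zero_mem _
  · obtain ⟨m, rfl⟩ : ∃ m, n = m + 1 := ⟨n - 1, by grind⟩
    obtain ⟨j, rfl⟩ := Fin.exists_succAbove_eq h
    rw [pull_congr X (degeneracyMap_comp_faceMap i j _),
      pull_congr X (degeneracyMap_comp_faceMap i j _),
      ← pull_pull X (.face _ _) (.degeneracy _), ← pull_pull X (.face _ _) (.degeneracy _)]
    exact Submodule.sub_mem _ (Submodule.mem_iSup_of_mem j ⟨_, rfl⟩)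
      (Submodule.mem_iSup_of_mem j ⟨_, rfl⟩)

lemma faceDiff_add_pull_mem {k n : ℕ} {t : Vertex (n + 1) → Vertex (n + 1)} (ht : IsSimple A t)
    {s : Vertex n → Vertex n} (hs : IsSimpleBelow A k s) (j : Fin (n + 1))
    (h : ∀ ε, t ∘ faceMap j ε = faceMap j ε ∘ s) (x : cubes X (n + 1)) :
    faceDiff X j (x + pull X t (.simple ht) x) ∈ symmFiltration X k n := by
  have h' : faceDiff X j (pull X t (.simple ht) x) =
      pull X s (.simple hs.isSimple) (faceDiff X j x) := by
    simp only [faceDiff, LinearMap.sub_apply, map_sub, pull_pull]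
    rw [pull_congr X (h _), pull_congr X (h _)]
  rw [map_add, h']
  exact add_pull_mem_symmFiltration X hs _

/-- The faces affected by `s` cancel on `x + s x`. Each other face among the first `k + 1` removes
one of these coordinates and turns `s` into a simple symmetry of the first `k`, hence the drop in
the filtration. -/
lemma lowerBoundary_mem_symmFiltration (k n : ℕ) {x : cubes X (n + 1)}
    (hx : x ∈ symmFiltration X (k + 1) (n + 1)) :
    lowerBoundary X (k + 1) n x ∈ symmFiltration X k n := by
  suffices h : symmFiltration X (k + 1) (n + 1) ≤
    (symmFiltration X k n).comap (lowerBoundary X (k + 1) n) from h hx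
  refine symmFiltration_le X ?_ fun s hs x => ?_
  · intro x hx
    simp only [Submodule.mem_comap, lowerBoundary, LinearMap.sum_apply]
    refine Submodule.sum_mem _ fun i _ => degenerate_le_symmFiltration X k n ?_
    split_ifs
    · exact zsmul_mem (faceDiff_mem_degenerate X i hx) _
    · exact Submodule.zero_mem _
  · rw [Submodule.mem_comap]
    simp only [lowerBoundary, LinearMap.sum_apply]
    cases hs with
    | transposition h i hi =>
      have hne : i.castSucc ≠ i.succ := (Fin.castSucc_lt_succ (i := i)).ne
      rw [← Finset.add_sum_erase _ _ (Finset.mem_univ i.castSucc),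
        ← Finset.add_sum_erase _ _ (Finset.mem_erase.mpr ⟨hne.symm, Finset.mem_univ i.succ⟩),
        ← add_assoc]
      refine Submodule.add_mem _ ?_ (Submodule.sum_mem _ fun j hj => ?_)
      -- The transposition exchanges the faces `i` and `i + 1`, which carry opposite signs.
      · convert Submodule.zero_mem _
        have h1 : (i.castSucc : ℕ) < k + 1 := by simp; omega
        have h2 : (i.succ : ℕ) < k + 1 := by simp; omega
        simp only [h1, h2, if_true, LinearMap.smul_apply, faceDiff, LinearMap.sub_apply, map_add,
          pull_pull, pull_congr X (transpositionMap_comp_faceMap_castSucc i _),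
          pull_congr X (transpositionMap_comp_faceMap_succ i _)]
        simp only [Fin.val_castSucc, Fin.val_succ, pow_succ, mul_neg, mul_one, neg_smul, smul_sub]
        abel
      · simp only [Finset.mem_erase, Finset.mem_univ, and_true] at hj
        split_ifs with hjk
        · obtain ⟨s, hs, h'⟩ := transpositionMap_comp_faceMap h i hi j hjk hj.2 hj.1
          exact zsmul_mem (faceDiff_add_pull_mem X (.transposition h i) hs j h' x) _
        · exact Submodule.zero_mem _
    | reversal h i hi =>
      refine Submodule.sum_mem _ fun j _ => ?_
      split_ifs with hjk
      · refine zsmul_mem ?_ _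
        by_cases hji : j = i
        · subst hji
          -- The reversal exchanges the two opposite faces, so it changes the sign of their
          -- difference.
          convert Submodule.zero_mem _
          simp only [faceDiff, LinearMap.sub_apply, map_add,
            pull_pull, pull_congr X (reversalMap_comp_faceMap_self j _), Bool.not_true,
            Bool.not_false]
          abel
        · obtain ⟨s, hs, h'⟩ := reversalMap_comp_faceMap h i hi j hjk hji
          exact faceDiff_add_pull_mem X (.reversal h i) hs j h' x
      · exact Submodule.zero_mem _

end CubicalSymm

namespace CubicalSymm

/-! ### The group of symmetries of the first coordinates -/

noncomputable instance (A : Set SymmKind) (k : ℕ) :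
    Fintype {t : Vertex k → Vertex k // IsSymmetry A t} :=
  Fintype.ofFinite _

/-- Composition with a simple symmetry, as a permutation of the symmetries. -/
def simpleCompPerm {A : Set SymmKind} {k : ℕ} {s : Vertex k → Vertex k} (hs : IsSimple A s) :
    Equiv.Perm {t : Vertex k → Vertex k // IsSymmetry A t} :=
  Function.Involutive.toPerm (fun t => ⟨s ∘ t.1, t.2.comp_simple hs⟩) fun t => by
    ext1
    simp only [← Function.comp_assoc, hs.comp_self, Function.id_comp]

/-- The composition of the reversals of the coordinates in `s`. -/
def reversals {k : ℕ} (s : Finset (Fin k)) : Vertex k → Vertex k :=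
  fun v i => if i ∈ s then !(v i) else v i

lemma isSymmetry_reversal_iff {k : ℕ} (t : Vertex k → Vertex k) :
    IsSymmetry {SymmKind.reversal} t ↔ ∃ s, reversals s = t := by
  -- Composing with one more reversal toggles the membership of `a`.
  have key : ∀ (a : Fin k) (s : Finset (Fin k)),
      reversalMap a ∘ reversals s = reversals (if a ∈ s then s.erase a else insert a s) := by
    intro a s
    funext v i
    simp only [Function.comp, reversalMap, reversals, Function.update_apply]
    split_ifs <;> grind
  constructor
  · rintro ⟨l, h⟩
    induction h with
    | nil => exact ⟨∅, by funext v i; simp [reversals]⟩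
    | cons hg _ ih =>
      obtain ⟨s, rfl⟩ := ih
      cases hg with
      | transposition h => simp at h
      | reversal _ a => exact ⟨_, (key a s).symm⟩
  · rintro ⟨s, rfl⟩
    induction s using Finset.induction_on with
    | empty => exact ⟨0, by convert IsComposite.nil; funext v i; simp [reversals]⟩
    | insert a s ha ih =>
      obtain ⟨l, hl⟩ := ih
      refine ⟨l + 1, ?_⟩
      have := key a s
      rw [if_neg ha] at this
      rw [← this]
      exact .cons (.reversal (Set.mem_singleton _) a) hl

lemma card_reversal_symmetries (k : ℕ) :
    Fintype.card {t : Vertex k → Vertex k // IsSymmetry {SymmKind.reversal} t} = 2 ^ k := by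
  have hinj : Function.Injective (reversals : Finset (Fin k) → Vertex k → Vertex k) := by
    intro s s' h
    ext i
    have := congrFun (congrFun h fun _ => false) i
    simpa [reversals] using this
  have e : Finset (Fin k) ≃ {t : Vertex k → Vertex k // IsSymmetry {SymmKind.reversal} t} :=
    Equiv.ofBijective (fun s => ⟨reversals s, (isSymmetry_reversal_iff _).mpr ⟨s, rfl⟩⟩)
      ⟨fun s s' h => hinj (congrArg Subtype.val h), fun t => by
        obtain ⟨s, hs⟩ := (isSymmetry_reversal_iff _).mp t.2
        exact ⟨s, Subtype.ext hs⟩⟩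
  rw [← Fintype.card_congr e]
  simp

lemma card_symmetries_ne_zero {R : Type u} [Field R] {A : Set SymmKind}
    (hR : CharZero R ∨ (A = {SymmKind.reversal} ∧ ringChar R ≠ 2)) (k : ℕ) :
    (Fintype.card {t : Vertex k → Vertex k // IsSymmetry A t} : R) ≠ 0 := by
  rcases hR with hR | ⟨rfl, hR⟩
  · have : Nonempty {t : Vertex k → Vertex k // IsSymmetry A t} := ⟨⟨id, 0, .nil⟩⟩
    exact Nat.cast_ne_zero.mpr Fintype.card_ne_zero
  · rw [card_reversal_symmetries]
    push_cast
    exact pow_ne_zero _ (Ring.two_ne_zero hR)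

variable {A : Set SymmKind} {R : Type u} [Ring R] (X : CubicalModule.{u, v} A R)

/-! ### Antisymmetrization in the first coordinates -/

/-- The operator `x ↦ ∑ (x - sgn(t) t x)`, where `t` runs through the symmetries of the first `k`
coordinates. -/
noncomputable def antisymmDefect {k n : ℕ} (h : k ≤ n) : cubes X n →ₗ[R] cubes X n :=
  ∑ t : {t : Vertex k → Vertex k // IsSymmetry A t},
    (LinearMap.id - sgn t.1 • pull X (extendMap n t.1) (t.2.extendMap h).isCubeMap)

lemma antisymmDefect_mem {k n : ℕ} (h : k ≤ n) (x : cubes X n) :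
    antisymmDefect X h x ∈ symmFiltration X k n := by
  simp only [antisymmDefect, LinearMap.sum_apply]
  refine Submodule.sum_mem _ fun ⟨t, l, ht⟩ _ => ?_
  have := sub_zsmul_pull_mem_symmFiltration X h ht x
  rw [← ht.sgn_eq] at this
  exact this

lemma antisymmDefect_apply {k n : ℕ} (h : k ≤ n) (x : cubes X n) :
    antisymmDefect X h x =
      (Fintype.card {t : Vertex k → Vertex k // IsSymmetry A t} : R) • x -
        ∑ t : {t : Vertex k → Vertex k // IsSymmetry A t},
          sgn t.1 • pull X (extendMap n t.1) (t.2.extendMap h).isCubeMap x := by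
  simp [antisymmDefect, LinearMap.sum_apply, Nat.cast_smul_eq_nsmul]

/-- The difference is `∑ sgn(t) t x`. On `y + s y` its terms cancel in pairs: `t ↦ s ∘ t` permutes
the symmetries and flips the sign. So on `F_k`, modulo degenerate cubes, the operator is
multiplication by the order of the group. -/
lemma antisymmDefect_sub_mem {k n : ℕ} (h : k ≤ n) {x : cubes X n}
    (hx : x ∈ symmFiltration X k n) :
    (Fintype.card {t : Vertex k → Vertex k // IsSymmetry A t} : R) • x - antisymmDefect X h x ∈
      degenerate X n := by
  rw [antisymmDefect_apply, sub_sub_cancel]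
  set e : cubes X n →ₗ[R] cubes X n := ∑ t : {t : Vertex k → Vertex k // IsSymmetry A t},
    sgn t.1 • pull X (extendMap n t.1) (t.2.extendMap h).isCubeMap with he
  have he' : ∀ x, ∑ t : {t : Vertex k → Vertex k // IsSymmetry A t},
    sgn t.1 • pull X (extendMap n t.1) (t.2.extendMap h).isCubeMap x = e x := by
    intro x
    rw [he, LinearMap.sum_apply]
    rfl
  rw [he']
  suffices H : symmFiltration X k n ≤ (degenerate X n).comap e from H hx
  refine symmFiltration_le X ?_ fun s hs y => ?_
  · intro y hy
    rw [Submodule.mem_comap, ← he']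
    exact Submodule.sum_mem _ fun t _ =>
      zsmul_mem (Submodule.mem_comap.mp (pull_degenerate X (t.2.extendMap h) hy)) _
  · rw [Submodule.mem_comap]
    convert Submodule.zero_mem _
    obtain ⟨s, hs', rfl⟩ := hs.exists_extendMap h
    rw [map_add, ← he', ← he', ← Equiv.sum_comp (simpleCompPerm hs'), ← Finset.sum_add_distrib]
    refine Finset.sum_eq_zero fun t _ => ?_
    rw [pull_pull, pull_congr X (extendMap_comp h s t.1).symm]
    have : sgn (simpleCompPerm hs' t).1 = - sgn t.1 := sgn_simple_comp hs' t.2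
    rw [this, neg_smul]
    exact neg_add_cancel _

/-- A single symmetry of the first `k` coordinates need not preserve `F_l`; the whole sum does,
since on `F_l ⊆ F_k` it is a scalar modulo degenerate cubes. -/
lemma antisymmDefect_mem_of_le {k l n : ℕ} (h : k ≤ n) (hl : l ≤ k) {x : cubes X n}
    (hx : x ∈ symmFiltration X l n) : antisymmDefect X h x ∈ symmFiltration X l n := by
  have h' := antisymmDefect_sub_mem X h (symmFiltration_mono X hl n hx)
  have := Submodule.sub_mem _ (Submodule.smul_mem _
    (Fintype.card {t : Vertex k → Vertex k // IsSymmetry A t} : R) hx)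
    (degenerate_le_symmFiltration X l n h')
  rwa [sub_sub_cancel] at this

lemma faceDiff_antisymmDefect {k n : ℕ} (h : k ≤ n) (j : Fin (n + 1)) (hj : k ≤ j)
    (x : cubes X (n + 1)) :
    faceDiff X j (antisymmDefect X (h.trans n.le_succ) x) =
      antisymmDefect X h (faceDiff X j x) := by
  simp only [antisymmDefect, LinearMap.sum_apply, map_sum]
  refine Finset.sum_congr rfl fun t _ => ?_
  simp only [LinearMap.sub_apply, LinearMap.id_apply, LinearMap.smul_apply, map_sub, map_zsmul,
    faceDiff, pull_pull, pull_congr X (extendMap_comp_faceMap t.1 j hj _), smul_sub]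
  abel

/-! ### Connections -/

/-- The connection that replaces the coordinate `v_i` by the maximum of `v_i` and `v_{i+1}`. -/
def connection {n : ℕ} (i : Fin n) : cubes X n →ₗ[R] cubes X (n + 1) :=
  pull X (connectionMap i false) (.connection i false)

lemma connection_mem_symmFiltration {n : ℕ} (i : Fin n) {x : cubes X n}
    (hx : x ∈ symmFiltration X i n) : connection X i x ∈ symmFiltration X i (n + 1) := by
  suffices H : symmFiltration X i n ≤ (symmFiltration X i (n + 1)).comap (connection X i) from H hx
  refine symmFiltration_le X ?_ fun s hs y => ?_
  · obtain ⟨m, rfl⟩ : ∃ m, n = m + 1 := ⟨n - 1, by have := i.2; omega⟩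
    refine iSup_le fun l => ?_
    rintro _ ⟨y, rfl⟩
    obtain ⟨j, hj⟩ := isIndepOf_degeneracyMap_comp_connectionMap l i false
    rw [Submodule.mem_comap, connection, pull_pull]
    exact degenerate_le_symmFiltration X _ _ (pull_mem_degenerate X _ hj y)
  · obtain ⟨s', hs', h⟩ := hs.comp_connectionMap i false
    rw [Submodule.mem_comap, map_add, connection, pull_pull, pull_congr X h,
      ← pull_pull X (.connection i false) (.simple hs'.isSimple)]
    exact add_pull_mem_symmFiltration X hs' _

/-- One face of the connection is `x`, the opposite one is degenerate; this makes the connection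
usable as a contraction. -/
lemma faceDiff_succ_connection_sub_mem {n : ℕ} (i : Fin n) (x : cubes X n) :
    faceDiff X i.succ (connection X i x) - x ∈ degenerate X n := by
  obtain ⟨m, rfl⟩ : ∃ m, n = m + 1 := ⟨n - 1, by have := i.2; omega⟩
  simp only [connection, faceDiff, LinearMap.sub_apply, pull_pull]
  rw [pull_congr X (connectionMap_comp_faceMap_succ i false), pull_id, sub_sub_cancel_left]
  exact Submodule.neg_mem _
    (pull_mem_degenerate X _ (isIndepOf_connectionMap_comp_faceMap_succ i false) x)

lemma faceDiff_succ_connection {n : ℕ} (i : Fin n) (j : Fin (n + 1)) (hj : (i : ℕ) < j)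
    (x : cubes X (n + 1)) :
    faceDiff X j.succ (connection X i.castSucc x) = connection X i (faceDiff X j x) := by
  simp only [connection, faceDiff, LinearMap.sub_apply, map_sub, pull_pull,
    pull_congr X (connectionMap_comp_faceMap_above i _ _ j hj)]

/-! ### The contraction -/

/-- These faces commute with the antisymmetrization and pass through the connection with index
lowered by one; the shift produces the minus sign. -/
lemma upperBoundary_antisymmDefect_connection {n : ℕ} (i : Fin n) (x : cubes X (n + 1)) :
    upperBoundary X (i + 2) (n + 1) (antisymmDefect X (k := i + 1) (by omega)
      (connection X i.castSucc x)) =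
    - antisymmDefect X (k := i + 1) (by omega)
      (connection X i (upperBoundary X (i + 1) n x)) := by
  simp only [upperBoundary, LinearMap.sum_apply, map_sum]
  rw [Fin.sum_univ_succ]
  simp only [Fin.val_zero, Nat.zero_lt_succ, if_true, LinearMap.zero_apply, zero_add, Fin.val_succ]
  rw [← Finset.sum_neg_distrib]
  refine Finset.sum_congr rfl fun j _ => ?_
  by_cases hj : (j : ℕ) < i + 1
  · rw [if_pos hj, if_pos (by omega)]
    simp
  · rw [if_neg hj, if_neg (by omega)]
    simp only [LinearMap.smul_apply, map_zsmul]
    rw [faceDiff_antisymmDefect X (by omega) _ (by simp; omega),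
      faceDiff_succ_connection X i j (by omega), pow_succ, mul_neg_one, neg_smul]

lemma exists_boundary_sub_mem {n : ℕ} (i : Fin (n + 1)) {y : cubes X (n + 1)}
    (hy : y ∈ symmFiltration X (i + 1) (n + 1)) (hd : cubeBoundary X n y ∈ degenerate X n) :
    ∃ u ∈ symmFiltration X (i + 1) (n + 2),
      (Fintype.card {t : Vertex (i + 1) → Vertex (i + 1) // IsSymmetry A t} : R) • y -
        cubeBoundary X (n + 1) u ∈ symmFiltration X i (n + 1) := by
  have h1 : (i : ℕ) + 1 ≤ n + 1 := by omega
  set w := antisymmDefect X (h1.trans (Nat.le_succ _)) (connection X i y) with hw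
  have hwF : w ∈ symmFiltration X (i + 1) (n + 2) := antisymmDefect_mem X _ _
  -- The factor cancels the sign of the face `i + 1` in the boundary, the face that recovers `y`.
  refine ⟨(-1 : ℤ) ^ ((i : ℕ) + 1) • w, zsmul_mem hwF _, ?_⟩
  have hD := degenerate_le_symmFiltration X i (n + 1)
  have hlow := lowerBoundary_mem_symmFiltration X i (n + 1) hwF
  have hup : upperBoundary X (i + 2) (n + 1) w ∈ symmFiltration X i (n + 1) := by
    rcases Nat.lt_or_ge i n with hi | hi
    · obtain ⟨i', rfl⟩ : ∃ i' : Fin n, i = i'.castSucc := ⟨⟨i, hi⟩, rfl⟩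
      have := upperBoundary_antisymmDefect_connection X i' y
      rw [Fin.val_castSucc] at *
      rw [hw, this]
      refine Submodule.neg_mem _ (antisymmDefect_mem_of_le X _ (Nat.le_succ _)
        (connection_mem_symmFiltration X i' ?_))
      -- The full boundary of `y` is degenerate and its lower part lies in `F_i`, hence so does its
      -- upper part.
      have h2 := lowerBoundary_add_upperBoundary X (i' + 1) n
      rw [← h2] at hd
      have h3 := Submodule.sub_mem _ (degenerate_le_symmFiltration X i' n hd)
        (lowerBoundary_mem_symmFiltration X i' n hy)
      rwa [LinearMap.add_apply, add_sub_cancel_left] at h3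
    -- The connection uses the last coordinate of `y`, so no faces remain above it.
    · have : (i : ℕ) = n := by omega
      rw [this, upperBoundary_self]
      exact Submodule.zero_mem _
  have hmid : (Fintype.card {t : Vertex (i + 1) → Vertex (i + 1) // IsSymmetry A t} : R) • y -
      faceDiff X i.succ w ∈ symmFiltration X i (n + 1) := by
    rw [hw, faceDiff_antisymmDefect X h1 _ (by simp)]
    have h2 := antisymmDefect_sub_mem X h1 hy
    have h3 := antisymmDefect_mem_of_le X h1 (Nat.le_succ _)
      (hD (faceDiff_succ_connection_sub_mem X i y))
    rw [map_sub] at h3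
    have h4 := Submodule.sub_mem _ (hD h2) h3
    rwa [sub_sub_sub_cancel_right] at h4
  rw [map_zsmul, ← lowerBoundary_add_upperBoundary X (i + 1) (n + 1),
    upperBoundary_eq_add X (k := i + 1) (by omega)]
  have hsq : (-1 : ℤ) ^ ((i : ℕ) + 1) * (-1) ^ ((i : ℕ) + 1) = 1 := by simp [← mul_pow]
  simp only [LinearMap.add_apply, LinearMap.smul_apply, smul_add, smul_smul, hsq, one_smul]
  convert Submodule.sub_mem _ hmid (Submodule.add_mem _ (zsmul_mem hlow ((-1 : ℤ) ^ ((i : ℕ) + 1)))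
    (zsmul_mem hup ((-1 : ℤ) ^ ((i : ℕ) + 1)))) using 1
  rw [show (⟨(i : ℕ) + 1, by omega⟩ : Fin (n + 2)) = i.succ from rfl]
  abel

lemma cubeBoundary_mem_symmFiltration (n : ℕ) {x : cubes X (n + 1)}
    (hx : x ∈ symmFiltration X (n + 1) (n + 1)) :
    cubeBoundary X n x ∈ symmFiltration X n n := by
  have := lowerBoundary_mem_symmFiltration X n n hx
  rwa [lowerBoundary_self] at this

lemma exists_boundary_of_mem_symmFiltration {R : Type u} [Field R] (X : CubicalModule.{u, v} A R)
    (hR : CharZero R ∨ (A = {SymmKind.reversal} ∧ ringChar R ≠ 2)) {n : ℕ} (k : ℕ)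
    (hk : k ≤ n + 1) {y : cubes X (n + 1)} (hy : y ∈ symmFiltration X k (n + 1))
    (hd : cubeBoundary X n y ∈ degenerate X n) :
    ∃ u ∈ symmFiltration X (n + 2) (n + 2),
      y - cubeBoundary X (n + 1) u ∈ degenerate X (n + 1) := by
  induction k generalizing y with
  | zero =>
    rw [symmFiltration_zero] at hy
    exact ⟨0, Submodule.zero_mem _, by simpa using hy⟩
  | succ k ih =>
    obtain ⟨u, hu, h⟩ := exists_boundary_sub_mem X ⟨k, hk⟩ hy hd
    set N : R := (Fintype.card {t : Vertex (k + 1) → Vertex (k + 1) // IsSymmetry A t} : R)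
    have hN : N ≠ 0 := card_symmetries_ne_zero hR _
    -- Dividing by `N` leaves `y` minus a boundary, again a cycle modulo degenerate cubes and one
    -- filtration step lower.
    have h' := Submodule.smul_mem _ N⁻¹ h
    rw [smul_sub, smul_smul, inv_mul_cancel₀ hN, one_smul, ← map_smul] at h'
    obtain ⟨u', hu', h''⟩ := ih (by omega) h' (by
      rw [map_sub, cubeBoundary_cubeBoundary, sub_zero]
      exact hd)
    refine ⟨N⁻¹ • u + u', Submodule.add_mem _ (Submodule.smul_mem _ _
      (symmFiltration_mono X (by omega) _ hu)) hu', ?_⟩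
    rwa [map_add, ← sub_sub]

end CubicalSymm

namespace CubicalSymm

/-! ### Sub-complexes and homology -/

namespace Subcomplex

variable {R : Type u} [Ring R] {ι : Type*} {c : ComplexShape ι}
  {K : HomologicalComplex (ModuleCat.{v} R) c}

/-- The inclusion of a sub-complex. -/
def incl (T : Subcomplex K) : T.toComplex ⟶ K where
  f i := ModuleCat.ofHom (T.carrier i).subtype
  comm' _ _ _ := rfl

lemma incl_proj (T : Subcomplex K) : T.incl ≫ T.proj = 0 := by
  ext i x
  exact (Submodule.Quotient.mk_eq_zero _).mpr x.2

lemma shortExact (T : Subcomplex K) : (ShortComplex.mk T.incl T.proj T.incl_proj).ShortExact := by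
  refine HomologicalComplex.shortExact_of_degreewise_shortExact _ fun i => ?_
  have : Mono (ModuleCat.ofHom (T.carrier i).subtype) :=
    (ModuleCat.mono_iff_injective _).mpr Subtype.val_injective
  have : Epi (ModuleCat.ofHom (T.carrier i).mkQ) :=
    (ModuleCat.epi_iff_surjective _).mpr (Submodule.mkQ_surjective _)
  refine ShortComplex.ShortExact.mk' ?_ ‹Mono _› ‹Epi _›
  rw [ShortComplex.moduleCat_exact_iff]
  exact fun x hx => ⟨⟨x, (Submodule.Quotient.mk_eq_zero _).mp hx⟩, rfl⟩

lemma isIso_homologyMap_proj (T : Subcomplex K) (hT : T.toComplex.Acyclic) (i : ι) :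
    IsIso (HomologicalComplex.homologyMap T.proj i) := by
  have hzero : ∀ j, Limits.IsZero (T.toComplex.homology j) := fun j => (hT j).isZero_homology
  have hmono : Mono (HomologicalComplex.homologyMap T.proj i) :=
    (T.shortExact.homology_exact₂ i).mono_g ((hzero i).eq_of_src _ _)
  have hepi : Epi (HomologicalComplex.homologyMap T.proj i) := by
    by_cases h : c.Rel i (c.next i)
    · exact (T.shortExact.homology_exact₃ i _ h).epi_f ((hzero _).eq_of_tgt _ _)
    -- Without an outgoing differential the homology equals the opcycles, and an epimorphism of
    -- complexes is epi on opcycles.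
    · have := T.shortExact.epi_g
      have hι : ∀ L : HomologicalComplex (ModuleCat.{v} R) c, IsIso (L.homologyι i) :=
        fun L => ShortComplex.isIso_homologyι (L.sc i) (L.shape _ _ h)
      have hcomp : Epi (HomologicalComplex.homologyMap T.proj i ≫ T.quotient.homologyι i) := by
        rw [HomologicalComplex.homologyι_naturality]
        exact epi_comp _ _
      rw [show HomologicalComplex.homologyMap T.proj i =
        (HomologicalComplex.homologyMap T.proj i ≫ T.quotient.homologyι i) ≫
          inv (T.quotient.homologyι i) by rw [Category.assoc, IsIso.hom_inv_id, Category.comp_id]]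
      exact epi_comp _ _
  exact isIso_of_mono_of_epi _

end Subcomplex

lemma IsClassOf.zsmul {R : Type u} [Ring R] {ι : Type*} {c : ComplexShape ι}
    {K : HomologicalComplex (ModuleCat.{v} R) c} {i : ι} {h : K.homology i} {x : K.X i}
    (hx : IsClassOf h x) (a : ℤ) : IsClassOf (a • h) (a • x) := by
  obtain ⟨z, rfl, rfl⟩ := hx
  exact ⟨a • z, map_zsmul _ _ _, map_zsmul _ _ _⟩

/-! ### The symmetry sub-complex -/

variable {A : Set SymmKind} {R : Type u} [Ring R] (X : CubicalModule.{u, v} A R)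

/-- The projection of the cubes onto the chains. -/
def toChains (n : ℕ) : cubes X n →ₗ[R] (cubeComplex X).X n :=
  (degenerate X n).mkQ

lemma toChains_surjective (n : ℕ) : Function.Surjective (toChains X n) :=
  Submodule.mkQ_surjective _

lemma toChains_eq_zero_iff {n : ℕ} {x : cubes X n} :
    toChains X n x = 0 ↔ x ∈ degenerate X n :=
  Submodule.Quotient.mk_eq_zero _

lemma symmAct_toChains {n : ℕ} {t : Vertex n → Vertex n} (ht : IsSymmetry A t) (x : cubes X n) :
    symmAct X t ht (toChains X n x) = toChains X n (pull X t ht.isCubeMap x) :=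
  rfl

lemma cubeComplex_d_toChains (n : ℕ) (x : cubes X (n + 1)) :
    ((cubeComplex X).d (n + 1) n).hom (toChains X (n + 1) x) =
      toChains X n (cubeBoundary X n x) := by
  simp only [cubeComplex, ChainComplex.of_d]
  rfl

lemma span_symmChains (n : ℕ) :
    Submodule.span R (symmChains X n) = (symmFiltration X n n).map (toChains X n) := by
  apply le_antisymm
  · rw [Submodule.span_le]
    rintro _ ⟨t, ht, x, rfl⟩
    obtain ⟨x, rfl⟩ := toChains_surjective X n x
    obtain ⟨m, hm⟩ := id ht
    have h := sub_zsmul_pull_mem_symmFiltration X le_rfl hm x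
    rw [pull_congr X (extendMap_self t), ← hm.sgn_eq] at h
    refine ⟨_, h, ?_⟩
    rw [map_sub, map_zsmul, symmAct_toChains]
  · rw [Submodule.map_le_iff_le_comap]
    refine symmFiltration_le X ?_ fun s hs x => ?_
    · intro x hx
      rw [Submodule.mem_comap, (toChains_eq_zero_iff X).mpr hx]
      exact Submodule.zero_mem _
    · refine Submodule.subset_span ⟨s, hs.isSimple.isSymmetry, toChains X n x, ?_⟩
      rw [hs.isSimple.isComposite.sgn_eq, symmAct_toChains, map_add, pow_one, neg_one_smul,
        sub_neg_eq_add]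

/-- The sub-complex whose chains are the linear combinations of the chains `x - sgn(t) t x`. -/
noncomputable def symmSpan : Subcomplex (cubeComplex X) where
  carrier n := Submodule.span R (symmChains X n)
  d_mem i j x hx := by
    by_cases hij : (ComplexShape.down ℕ).Rel i j
    · obtain rfl : j + 1 = i := hij
      rw [span_symmChains] at hx ⊢
      obtain ⟨y, hy, rfl⟩ := hx
      rw [cubeComplex_d_toChains]
      exact ⟨_, cubeBoundary_mem_symmFiltration X j hy, rfl⟩
    · rw [(cubeComplex X).shape i j hij]
      exact Submodule.zero_mem _

/-- The spans are already closed under the differential (`symmSpan`), so generating a sub-complex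
adds nothing. -/
lemma symmSubcomplex_carrier (n : ℕ) :
    (symmSubcomplex X).carrier n = Submodule.span R (symmChains X n) := by
  apply le_antisymm
  · exact iInf₂_le (symmSpan X) fun _ => Submodule.subset_span
  · exact le_iInf₂ fun T hT => Submodule.span_le.mpr (hT n)

lemma symmSubcomplex_acyclic {R : Type u} [Field R] (X : CubicalModule.{u, v} A R)
    (hR : CharZero R ∨ (A = {SymmKind.reversal} ∧ ringChar R ≠ 2)) :
    (symmSubcomplex X).toComplex.Acyclic := by
  have hcar : ∀ n, (symmSubcomplex X).carrier n = (symmFiltration X n n).map (toChains X n) :=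
    fun n => (symmSubcomplex_carrier X n).trans (span_symmChains X n)
  intro n
  cases n with
  | zero =>
    rw [HomologicalComplex.exactAt_iff' _ 1 0 0 (by simp) (by simp),
      ShortComplex.moduleCat_exact_iff]
    rintro ⟨x, hx⟩ -
    refine ⟨0, ?_⟩
    -- A `0`-cube has no coordinates, so the sub-complex vanishes in degree `0`.
    rw [hcar, symmFiltration_zero] at hx
    obtain ⟨y, hy, rfl⟩ := hx
    rw [map_zero]
    exact Subtype.ext ((toChains_eq_zero_iff X).mpr hy).symm
  | succ n =>
    rw [HomologicalComplex.exactAt_iff' _ (n + 2) (n + 1) n (by simp) (by simp),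
      ShortComplex.moduleCat_exact_iff]
    rintro ⟨x, hx⟩ hd
    have hd' : ((cubeComplex X).d (n + 1) n).hom x = 0 := congrArg Subtype.val hd
    have hx' := hx
    rw [hcar] at hx'
    obtain ⟨y, hy, rfl⟩ := hx'
    rw [cubeComplex_d_toChains, toChains_eq_zero_iff] at hd'
    obtain ⟨w, hw, h⟩ := exists_boundary_of_mem_symmFiltration X hR (n + 1) le_rfl hy hd'
    refine ⟨⟨toChains X (n + 2) w, by rw [hcar]; exact ⟨w, hw, rfl⟩⟩, Subtype.ext ?_⟩
    rw [← toChains_eq_zero_iff, map_sub, sub_eq_zero] at h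
    exact (cubeComplex_d_toChains X (n + 1) w).trans h.symm

lemma proj_symmAct {n : ℕ} {t : Vertex n → Vertex n} (ht : IsSymmetry A t)
    (x : (cubeComplex X).X n) :
    ((symmSubcomplex X).proj.f n).hom (symmAct X t ht x) =
      sgn t • ((symmSubcomplex X).proj.f n).hom x := by
  have h : x - sgn t • symmAct X t ht x ∈ (symmSubcomplex X).carrier n := by
    rw [symmSubcomplex_carrier]
    exact Submodule.subset_span ⟨t, ht, x, rfl⟩
  have h' : ((symmSubcomplex X).proj.f n).hom (x - sgn t • symmAct X t ht x) = 0 :=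
    (Submodule.Quotient.mk_eq_zero _).mpr h
  rw [map_sub, map_zsmul, sub_eq_zero] at h'
  rw [h', smul_smul, sgn_mul_self, one_smul]

end CubicalSymm

theorem theorem2p10 (R : Type u) [Field R] (A : Set SymmKind) (hA : A.Nonempty)
    (hR : CharZero R ∨ (A = {SymmKind.reversal} ∧ ringChar R ≠ 2))
    (X : CubicalModule.{u, v} A R) :
    -- in each degree, the `A`-symmetry sub-complex is spanned by the chains `x - sgn(t) t x`
    (∀ n, (symmSubcomplex X).carrier n = Submodule.span R (symmChains X n)) ∧
    -- the `A`-symmetry sub-complex is acyclic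
    (symmSubcomplex X).toComplex.Acyclic ∧
    -- the projection to the quotient induces isomorphisms of all homology modules
    (∀ n, IsIso (HomologicalComplex.homologyMap (symmSubcomplex X).proj n)) ∧
    -- `[t α] = sgn(t) [α]` in the homology of the quotient
    (∀ (n : ℕ) (t : Vertex n → Vertex n) (ht : IsSymmetry A t) (α : (cubeComplex X).X n)
      (h : (symmSubcomplex X).quotient.homology n),
      IsClassOf h (((symmSubcomplex X).proj.f n).hom α) →
        IsClassOf (sgn t • h) (((symmSubcomplex X).proj.f n).hom (symmAct X t ht α))) := by
  refine ⟨symmSubcomplex_carrier X, symmSubcomplex_acyclic X hR,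
    (symmSubcomplex X).isIso_homologyMap_proj (symmSubcomplex_acyclic X hR),
    fun n t ht α h hα => ?_⟩
  rw [proj_symmAct]
  exact hα.zsmul (sgn t)
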